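/- **Proposition (Fast rate implies stability).** Let $\mathcal X$ be a separable metric space with its Borel $\sigma$-algebra, $\mathcal Y$ a measurable space, and let $(X_1,Y_1),(X_2,Y_2),\dots$ be i.i.d. with law $P$, where $X\sim P_X$ and $Y\mid X=x\sim P_{Y|x}$. Write $\mathcal D_n=((X_i,Y_i))_{i\le n}$. Let $Z\subset\mathbb R^{d}$ and let $\ell:\mathbb R^d\times\mathcal Y\to\mathbb R$ be a measurable cost such that: 1. for every $x$, $v(z;x)=\mathbb E_{P_{Y|x}}[\ell(z;Y)]$ is twice differentiable in $z\in Z$; 2. for every $y$, $\ell(\cdot;y)$ is twice differentiable on $Z$, and $|\ell(z;y)|$ and $\|\nabla_z\ell(z;y)\|$ are bounded uniformly in $z\in Z$ and almost surely in $y$; 3. $Z$ is bounded and open, and for every $x$ a minimiser $z_o^*(x)$ of $v(\cdot;x)$ over $Z$ exists, with $\nabla_z v(z_o^*(x);x)=0$ and $\nabla_{zz}v(z_o^*(x);x)$ positive definite. Let $\hat z$ be a nonparametric learner: for every $n$, $\hat z(x)=\hat z_n(\mathcal D_n;x)\in Z$ depends measurably on $(\mathcal D_n,x)$, and almost surely,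 for all $x$, it minimises $\sum_{i\le n}w_{n,i}(x)\ell(z;Y_i)$ over $z\in Z$, where the real weights $w_{n,i}(x)$ are measurable functions of $\mathcal D_n$ and $x$. Let $\hat z^{(-i)}$ be the learner trained on the $n-1$ data points other than the $i$-th, let $X\sim P_X$ be independent of the data, and put $$\alpha_n=\max_{i\le n}\big(\mathbb E\|\hat z(X)-\hat z^{(-i)}(X)\|^2\big)^{1/2},\qquad \beta_n=\max_{i\le n}\mathbb E\|\hat z(X_i)-\hat z^{(-i)}(X_i)\| .$$ Suppose that $\hat z$ has variability rate $\gamma_v$, i.e. $\mathbb E\|\hat z(x)-\mathbb E\hat z(x)\|=\Theta(n^{-\gamma_v})$ for $P_X$-almost every $x$, and satisfies the following expansion conditions. A remainder $R_n(\mathcal D_n,x)$ is said to be $O(a_n)$ *in mean* if (for large $n$) it is integrable and $\mathbb E\|R_n(\mathcal D_n,X)\|=O(a_n)$, and likewise at the data points, $\max_{i\le n}\mathbb E\|R_n(\mathcal D_n,X_i)\|=O(a_n)$. * There is a deterministic $z_n(x)$ such that for all large $n$ and $P_X$-almost every $x$: $z_n(x)\in Z$ is a root of $\mathbb E[\sum_i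 w_{n,i}(x)\nabla_z\ell(z;Y_i)]=0$ (the sum being integrable at this root); for each $z\in Z$, $\sum_i w_{n,i}(x)\ell(z;Y_i)$ is integrable; $R_{n,x}(z)=\mathbb E[\frac1n\sum_i w_{n,i}(x)\ell(z;Y_i)]$ is differentiable on $Z$, its gradient is differentiable at $z_n(x)$, and the Hessian $H_{n,x}=\nabla^2R_{n,x}(z_n(x))$ is invertible. * In mean, $\hat z(x)-z_n(x)=-H_{n,x}^{-1}\frac1n\sum_{i}w_{n,i}(x)\nabla_z\ell(z_n(x);Y_i)+O(n^{-2\gamma_v})$. * One of the following holds. (a) *Nearest neighbours:* $w_{n,i}(x)$ is the indicator that $X_i$ is one of the $k_n$ nearest neighbours of $x$ in $\mathcal D_n$ (ties broken by the smaller index), where $k_n\le n$ is deterministic and $k_n=\Theta(n^{2\gamma_v})$; and, with $H_{k_n,x}=\frac{n}{k_n}H_{n,x}$ (the Hessian of the expected cost averaged over the $k_n$ neighbours), there are functions $g_n$ with $\mathbb E[g_n(X)^2]<\infty$ for every $n$, $\mathbb E[g_n(X)^2]=O(1)$, and, for all large $n$, $\|H_{k_n,x}^{-1}\|\le g_n(x)$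 for $P_X$-almost every $x$. (b) *Influence functions:* there are jointly measurable $\phi_{n,x}(x',y)\in\mathbb R^d$ such that, in mean, $\hat z(x)-z_n(x)=\frac1n\sum_i\phi_{n,x}(X_i,Y_i)+O(n^{-2\gamma_v})$; for all large $n$ and $P_X$-almost every $x$, $\phi_{n,x}(X,Y)$ is square integrable with $\mathbb E[\phi_{n,x}(X,Y)]=0$; for $P_X$-almost every $x$, $(\mathbb E\|\phi_{n,x}(X,Y)\|^2)^{1/2}=\Theta(n^{1/2-\gamma_v})$; and for all large $n$, $\phi_{n,X}(X,Y)$ is square integrable with $\mathbb E[\phi_{n,X}(X,Y)]=0$, and $(\mathbb E\|\phi_{n,X}(X,Y)\|^2)^{1/2}=O(n^{1-2\gamma_v})$. If $\alpha_n=o(n^{-1/2})$ and $\gamma_v>1/4$, then $\beta_n=o(n^{-1/2})$. -/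

import Mathlib

open MeasureTheory ProbabilityTheory Filter Asymptotics
open scoped Topology

namespace FastRate

noncomputable section

/-- The joint law of `(X, Y)`: `X` has law `pX` and `Y` given `X = x` has law `κ x`. -/
def jointLaw {𝒳 𝒴 : Type*} [MeasurableSpace 𝒳] [MeasurableSpace 𝒴]
    (pX : Measure 𝒳) (κ : Kernel 𝒳 𝒴) : Measure (𝒳 × 𝒴) :=
  pX ⊗ₘ κ

/-- The law of an i.i.d. data set `D = ((X_1, Y_1), …, (X_n, Y_n))`. -/
def dataLaw {𝒳 𝒴 : Type*} [MeasurableSpace 𝒳] [MeasurableSpace 𝒴]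
    (pX : Measure 𝒳) (κ : Kernel 𝒳 𝒴) (n : ℕ) : Measure (Fin n → 𝒳 × 𝒴) :=
  Measure.pi fun _ => jointLaw pX κ

/-! ### The cost function -/

/-- `f` is twice differentiable on the (open) set `Z`. -/
def TwiceDiffOn {d : ℕ} (f : EuclideanSpace ℝ (Fin d) → ℝ)
    (Z : Set (EuclideanSpace ℝ (Fin d))) : Prop :=
  DifferentiableOn ℝ f Z ∧ DifferentiableOn ℝ (gradient f) Z

/-- The Hessian of `f` at `z`, as a linear operator. -/
def hess {d : ℕ} (f : EuclideanSpace ℝ (Fin d) → ℝ) (z : EuclideanSpace ℝ (Fin d)) :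
    EuclideanSpace ℝ (Fin d) →L[ℝ] EuclideanSpace ℝ (Fin d) :=
  fderiv ℝ (gradient f) z

/-- The expected cost `v(z; x) = E[ℓ(z; Y) | X = x]`. -/
def expectedCost {𝒳 𝒴 : Type*} [MeasurableSpace 𝒳] [MeasurableSpace 𝒴] {d : ℕ}
    (κ : Kernel 𝒳 𝒴) (ℓ : EuclideanSpace ℝ (Fin d) → 𝒴 → ℝ) (x : 𝒳)
    (z : EuclideanSpace ℝ (Fin d)) : ℝ :=
  ∫ y, ℓ z y ∂(κ x)

/-- Smoothness of the expected cost. -/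
def SmoothExpectedCost {𝒳 𝒴 : Type*} [MeasurableSpace 𝒳] [MeasurableSpace 𝒴] {d : ℕ}
    (κ : Kernel 𝒳 𝒴) (ℓ : EuclideanSpace ℝ (Fin d) → 𝒴 → ℝ)
    (Z : Set (EuclideanSpace ℝ (Fin d))) : Prop :=
  ∀ x, TwiceDiffOn (expectedCost κ ℓ x) Z

/-- Regularity of the cost: twice differentiable in `z`, with cost and gradient bounded
uniformly in `z ∈ Z` and almost surely in `y`. -/
def RegularCost {𝒳 𝒴 : Type*} [MeasurableSpace 𝒳] [MeasurableSpace 𝒴] {d : ℕ}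
    (pX : Measure 𝒳) (κ : Kernel 𝒳 𝒴) (ℓ : EuclideanSpace ℝ (Fin d) → 𝒴 → ℝ)
    (Z : Set (EuclideanSpace ℝ (Fin d))) : Prop :=
  (∀ y, TwiceDiffOn (fun z => ℓ z y) Z) ∧
  ∃ M : ℝ, ∀ᵐ y ∂(jointLaw pX κ).snd, ∀ z ∈ Z,
    |ℓ z y| ≤ M ∧ ‖gradient (fun z => ℓ z y) z‖ ≤ M

/-- Optimality conditions: `Z` is bounded and open, and the best mapping `zo`, which minimises
`v(·; x)` over `Z` for every `x`, has zero gradient and positive definite Hessian there. -/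
def OptimalityConditions {𝒳 𝒴 : Type*} [MeasurableSpace 𝒳] [MeasurableSpace 𝒴] {d : ℕ}
    (κ : Kernel 𝒳 𝒴) (ℓ : EuclideanSpace ℝ (Fin d) → 𝒴 → ℝ)
    (Z : Set (EuclideanSpace ℝ (Fin d))) : Prop :=
  IsOpen Z ∧ Bornology.IsBounded Z ∧
  ∃ zo : 𝒳 → EuclideanSpace ℝ (Fin d), ∀ x,
    zo x ∈ Z ∧ IsMinOn (expectedCost κ ℓ x) Z (zo x) ∧
    gradient (expectedCost κ ℓ x) (zo x) = 0 ∧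
    ∀ u, u ≠ 0 → 0 < inner ℝ (hess (expectedCost κ ℓ x) (zo x) u) u

/-! ### Learners

A learner `zhat` maps a data set `D` of any size `n` to a decision mapping `x ↦ zhat n D x`.
The weights are `w n D i x`. -/

/-- The nonparametric model: `zhat n D x` minimises `∑ i, w_{n,i}(x) ℓ(z; Y_i)` over `Z`. -/
structure IsWeightedLearner {𝒳 𝒴 : Type*} [MeasurableSpace 𝒳] [MeasurableSpace 𝒴] {d : ℕ}
    (pX : Measure 𝒳) (κ : Kernel 𝒳 𝒴) (ℓ : EuclideanSpace ℝ (Fin d) → 𝒴 → ℝ)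
    (Z : Set (EuclideanSpace ℝ (Fin d)))
    (w : (n : ℕ) → (Fin n → 𝒳 × 𝒴) → Fin n → 𝒳 → ℝ)
    (zhat : (n : ℕ) → (Fin n → 𝒳 × 𝒴) → 𝒳 → EuclideanSpace ℝ (Fin d)) : Prop where
  measurable_w : ∀ n i, Measurable fun p : (Fin n → 𝒳 × 𝒴) × 𝒳 => w n p.1 i p.2
  measurable_zhat : ∀ n, Measurable fun p : (Fin n → 𝒳 × 𝒴) × 𝒳 => zhat n p.1 p.2
  mem : ∀ n D x, zhat n D x ∈ Z
  isMinOn : ∀ n, ∀ᵐ D ∂(dataLaw pX κ n), ∀ x,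
    IsMinOn (fun z => ∑ i, w n D i x * ℓ z (D i).2) Z (zhat n D x)

/-- `zhat` has variability convergence rate `γv`: for almost every `x`,
`E ‖zhat(x) - E zhat(x)‖ = Θ(n ^ (-γv))`. -/
def HasVariabilityRate {𝒳 𝒴 : Type*} [MeasurableSpace 𝒳] [MeasurableSpace 𝒴] {d : ℕ}
    (pX : Measure 𝒳) (κ : Kernel 𝒳 𝒴)
    (zhat : (n : ℕ) → (Fin n → 𝒳 × 𝒴) → 𝒳 → EuclideanSpace ℝ (Fin d)) (γv : ℝ) : Prop :=
  ∀ᵐ x ∂pX,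
    (fun n : ℕ => ∫ D, ‖zhat n D x - ∫ D', zhat n D' x ∂(dataLaw pX κ n)‖ ∂(dataLaw pX κ n))
      =Θ[atTop] fun n : ℕ => (n : ℝ) ^ (-γv)

/-- Expected LOO stability `α_n`, the maximum over `i` of
`(E ‖zhat(X) - zhat^{(-i)}(X)‖²)^{1/2}` with `X` independent of the data;
`zhat^{(-i)}` is trained on the `n - 1` points other than the `i`-th. -/
def expectedLOO {𝒳 𝒴 : Type*} [MeasurableSpace 𝒳] [MeasurableSpace 𝒴] {d : ℕ}
    (pX : Measure 𝒳) (κ : Kernel 𝒳 𝒴)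
    (zhat : (n : ℕ) → (Fin n → 𝒳 × 𝒴) → 𝒳 → EuclideanSpace ℝ (Fin d)) : ℕ → ℝ
  | 0 => 0
  | m + 1 => ⨆ i : Fin (m + 1),
      √(∫ p, ‖zhat (m + 1) p.1 p.2 - zhat m (i.removeNth p.1) p.2‖ ^ 2
        ∂((dataLaw pX κ (m + 1)).prod pX))

/-- Pointwise LOO stability `β_n`, the maximum over `i` of `E ‖zhat(X_i) - zhat^{(-i)}(X_i)‖`. -/
def pointwiseLOO {𝒳 𝒴 : Type*} [MeasurableSpace 𝒳] [MeasurableSpace 𝒴] {d : ℕ}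
    (pX : Measure 𝒳) (κ : Kernel 𝒳 𝒴)
    (zhat : (n : ℕ) → (Fin n → 𝒳 × 𝒴) → 𝒳 → EuclideanSpace ℝ (Fin d)) : ℕ → ℝ
  | 0 => 0
  | m + 1 => ⨆ i : Fin (m + 1),
      ∫ D, ‖zhat (m + 1) D (D i).1 - zhat m (i.removeNth D) (D i).1‖ ∂(dataLaw pX κ (m + 1))

/-! ### Expansion conditions -/

/-- A remainder `R n D x` is of order `a n` in mean, both at a new covariate `X` independent of
the data and, uniformly in `i`, at the covariates `X_i` of the data. -/
def MeanBigO {𝒳 𝒴 : Type*} [MeasurableSpace 𝒳] [MeasurableSpace 𝒴] {d : ℕ}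
    (pX : Measure 𝒳) (κ : Kernel 𝒳 𝒴)
    (R : (n : ℕ) → (Fin n → 𝒳 × 𝒴) → 𝒳 → EuclideanSpace ℝ (Fin d)) (a : ℕ → ℝ) : Prop :=
  (∀ᶠ n : ℕ in atTop, Integrable (fun p : (Fin n → 𝒳 × 𝒴) × 𝒳 => R n p.1 p.2)
      ((dataLaw pX κ n).prod pX)) ∧
  ((fun n => ∫ p, ‖R n p.1 p.2‖ ∂((dataLaw pX κ n).prod pX)) =O[atTop] a) ∧
  (∀ᶠ n : ℕ in atTop, ∀ i : Fin n, Integrable (fun D => R n D (D i).1) (dataLaw pX κ n)) ∧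
  ((fun n => ⨆ i : Fin n, ∫ D, ‖R n D (D i).1‖ ∂(dataLaw pX κ n)) =O[atTop] a)

/-- The expected weighted cost `E[(1/n) ∑ i, w_{n,i}(x) ℓ(z; Y_i)]`. -/
def weightedRisk {𝒳 𝒴 : Type*} [MeasurableSpace 𝒳] [MeasurableSpace 𝒴] {d : ℕ}
    (pX : Measure 𝒳) (κ : Kernel 𝒳 𝒴) (ℓ : EuclideanSpace ℝ (Fin d) → 𝒴 → ℝ)
    (w : (n : ℕ) → (Fin n → 𝒳 × 𝒴) → Fin n → 𝒳 → ℝ) (n : ℕ) (x : 𝒳)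
    (z : EuclideanSpace ℝ (Fin d)) : ℝ :=
  ∫ D, (n : ℝ)⁻¹ * ∑ i, w n D i x * ℓ z (D i).2 ∂(dataLaw pX κ n)

/-- `H_{n,x}`, the Hessian in `z` of the expected weighted cost, at `z = z_n(x)`. -/
def weightedHess {𝒳 𝒴 : Type*} [MeasurableSpace 𝒳] [MeasurableSpace 𝒴] {d : ℕ}
    (pX : Measure 𝒳) (κ : Kernel 𝒳 𝒴) (ℓ : EuclideanSpace ℝ (Fin d) → 𝒴 → ℝ)
    (w : (n : ℕ) → (Fin n → 𝒳 × 𝒴) → Fin n → 𝒳 → ℝ)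
    (zn : ℕ → 𝒳 → EuclideanSpace ℝ (Fin d)) (n : ℕ) (x : 𝒳) :
    EuclideanSpace ℝ (Fin d) →L[ℝ] EuclideanSpace ℝ (Fin d) :=
  hess (weightedRisk pX κ ℓ w n x) (zn n x)

/-- The weighted score `∑ i, w_{n,i}(x) ∇ℓ(z; Y_i)`. -/
def score {𝒳 𝒴 : Type*} {d : ℕ} (ℓ : EuclideanSpace ℝ (Fin d) → 𝒴 → ℝ)
    (w : (n : ℕ) → (Fin n → 𝒳 × 𝒴) → Fin n → 𝒳 → ℝ)
    (n : ℕ) (D : Fin n → 𝒳 × 𝒴) (x : 𝒳) (z : EuclideanSpace ℝ (Fin d)) :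
    EuclideanSpace ℝ (Fin d) :=
  ∑ i, w n D i x • gradient (fun z => ℓ z (D i).2) z

/-- `z_n(x)` is a root in `Z` of `E[∑ i, w_{n,i}(x) ∇ℓ(z; Y_i)] = 0` at which the expected
weighted cost has an invertible Hessian, for large `n` and almost every `x`. -/
def IsCentre {𝒳 𝒴 : Type*} [MeasurableSpace 𝒳] [MeasurableSpace 𝒴] {d : ℕ}
    (pX : Measure 𝒳) (κ : Kernel 𝒳 𝒴) (ℓ : EuclideanSpace ℝ (Fin d) → 𝒴 → ℝ)
    (Z : Set (EuclideanSpace ℝ (Fin d)))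
    (w : (n : ℕ) → (Fin n → 𝒳 × 𝒴) → Fin n → 𝒳 → ℝ)
    (zn : ℕ → 𝒳 → EuclideanSpace ℝ (Fin d)) : Prop :=
  ∀ᶠ n : ℕ in atTop, ∀ᵐ x ∂pX,
    zn n x ∈ Z ∧
    Integrable (fun D => score ℓ w n D x (zn n x)) (dataLaw pX κ n) ∧
    ∫ D, score ℓ w n D x (zn n x) ∂(dataLaw pX κ n) = 0 ∧
    (∀ z ∈ Z, Integrable (fun D : Fin n → 𝒳 × 𝒴 => ∑ i, w n D i x * ℓ z (D i).2)
      (dataLaw pX κ n)) ∧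
    DifferentiableOn ℝ (weightedRisk pX κ ℓ w n x) Z ∧
    DifferentiableAt ℝ (gradient (weightedRisk pX κ ℓ w n x)) (zn n x) ∧
    (weightedHess pX κ ℓ w zn n x).IsInvertible

/-- The expansion
`zhat(x) - z_n(x) = -H_{n,x}⁻¹ (1/n) ∑ i, w_{n,i}(x) ∇ℓ(z_n(x); Y_i) + O(n ^ (-2 γv))`. -/
def HasScoreExpansion {𝒳 𝒴 : Type*} [MeasurableSpace 𝒳] [MeasurableSpace 𝒴] {d : ℕ}
    (pX : Measure 𝒳) (κ : Kernel 𝒳 𝒴) (ℓ : EuclideanSpace ℝ (Fin d) → 𝒴 → ℝ)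
    (w : (n : ℕ) → (Fin n → 𝒳 × 𝒴) → Fin n → 𝒳 → ℝ)
    (zhat : (n : ℕ) → (Fin n → 𝒳 × 𝒴) → 𝒳 → EuclideanSpace ℝ (Fin d))
    (zn : ℕ → 𝒳 → EuclideanSpace ℝ (Fin d)) (γv : ℝ) : Prop :=
  MeanBigO pX κ
    (fun n D x => zhat n D x - zn n x +
      (weightedHess pX κ ℓ w zn n x).inverse ((n : ℝ)⁻¹ • score ℓ w n D x (zn n x)))
    (fun n => (n : ℝ) ^ (-(2 * γv)))

open scoped Classical in
/-- The indices of the `k` nearest neighbours of `x` in the data set; ties are broken in favour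
of the smaller index. -/
def nearestIndices {𝒳 𝒴 : Type*} [MetricSpace 𝒳] {n : ℕ} (k : ℕ) (D : Fin n → 𝒳 × 𝒴) (x : 𝒳) :
    Finset (Fin n) :=
  Finset.univ.filter fun i =>
    (Finset.univ.filter fun j =>
      dist (D j).1 x < dist (D i).1 x ∨ (dist (D j).1 x = dist (D i).1 x ∧ j < i)).card < k

open scoped Classical in
/-- The nearest neighbour class: `w_{n,i}(x)` is the indicator of `X_i` being among the `k_n`
nearest neighbours of `x`, with `k_n = Θ(n ^ (2 γv))`. The Hessian `H_{k_n,x}` of the expected cost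
averaged over the `k_n` neighbours is `(n / k_n) H_{n,x}`; the influence function
`φ_{n,x}(y) = -H_{k_n,x}⁻¹ ∇ℓ(z_n(x); y)` is controlled in mean square through `H_{k_n,x}⁻¹`. -/
def NearestNeighbourClass {𝒳 𝒴 : Type*} [MetricSpace 𝒳] [MeasurableSpace 𝒳] [MeasurableSpace 𝒴]
    {d : ℕ} (pX : Measure 𝒳) (κ : Kernel 𝒳 𝒴) (ℓ : EuclideanSpace ℝ (Fin d) → 𝒴 → ℝ)
    (w : (n : ℕ) → (Fin n → 𝒳 × 𝒴) → Fin n → 𝒳 → ℝ)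
    (zn : ℕ → 𝒳 → EuclideanSpace ℝ (Fin d)) (γv : ℝ) : Prop :=
  ∃ k : ℕ → ℕ,
    (∀ n, k n ≤ n) ∧
    ((fun n => (k n : ℝ)) =Θ[atTop] fun n : ℕ => (n : ℝ) ^ (2 * γv)) ∧
    (∀ n D i x, w n D i x = if i ∈ nearestIndices (k n) D x then 1 else 0) ∧
    ∃ g : ℕ → 𝒳 → ℝ,
      (∀ n, MemLp (g n) 2 pX) ∧
      ((fun n => ∫ x, g n x ^ 2 ∂pX) =O[atTop] fun _ : ℕ => (1 : ℝ)) ∧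
      ∀ᶠ n : ℕ in atTop, ∀ᵐ x ∂pX,
        ‖(((n : ℝ) / (k n : ℝ)) • weightedHess pX κ ℓ w zn n x).inverse‖ ≤ g n x

/-- The influence function class: up to `O(n ^ (-2 γv))`, `zhat(x) - z_n(x)` is the average of
`φ_{n,x}(X_i, Y_i)` for an influence function that is centred with root mean square
`Θ(n ^ (1/2 - γv))` for almost every `x`, and that at its own data point is centred with root
mean square `O(n ^ (1 - 2 γv))`. -/
def InfluenceClass {𝒳 𝒴 : Type*} [MeasurableSpace 𝒳] [MeasurableSpace 𝒴] {d : ℕ}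
    (pX : Measure 𝒳) (κ : Kernel 𝒳 𝒴)
    (zhat : (n : ℕ) → (Fin n → 𝒳 × 𝒴) → 𝒳 → EuclideanSpace ℝ (Fin d))
    (zn : ℕ → 𝒳 → EuclideanSpace ℝ (Fin d)) (γv : ℝ) : Prop :=
  ∃ φ : ℕ → 𝒳 → 𝒳 × 𝒴 → EuclideanSpace ℝ (Fin d),
    (∀ n, Measurable fun p : 𝒳 × (𝒳 × 𝒴) => φ n p.1 p.2) ∧
    MeanBigO pX κ
      (fun n D x => zhat n D x - zn n x - (n : ℝ)⁻¹ • ∑ i, φ n x (D i))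
      (fun n => (n : ℝ) ^ (-(2 * γv))) ∧
    (∀ᶠ n : ℕ in atTop, ∀ᵐ x ∂pX, MemLp (φ n x) 2 (jointLaw pX κ) ∧
      ∫ q, φ n x q ∂(jointLaw pX κ) = 0) ∧
    (∀ᵐ x ∂pX, (fun n => √(∫ q, ‖φ n x q‖ ^ 2 ∂(jointLaw pX κ)))
      =Θ[atTop] fun n : ℕ => (n : ℝ) ^ (1 / 2 - γv)) ∧
    (∀ᶠ n : ℕ in atTop, MemLp (fun q => φ n q.1 q) 2 (jointLaw pX κ) ∧
      ∫ q, φ n q.1 q ∂(jointLaw pX κ) = 0) ∧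
    ((fun n => √(∫ q, ‖φ n q.1 q‖ ^ 2 ∂(jointLaw pX κ)))
      =O[atTop] fun n : ℕ => (n : ℝ) ^ (1 - 2 * γv))

/-- The expansion conditions on the nonparametric model. -/
def ExpansionConditions {𝒳 𝒴 : Type*} [MetricSpace 𝒳] [MeasurableSpace 𝒳] [MeasurableSpace 𝒴]
    {d : ℕ} (pX : Measure 𝒳) (κ : Kernel 𝒳 𝒴) (ℓ : EuclideanSpace ℝ (Fin d) → 𝒴 → ℝ)
    (Z : Set (EuclideanSpace ℝ (Fin d)))
    (w : (n : ℕ) → (Fin n → 𝒳 × 𝒴) → Fin n → 𝒳 → ℝ)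
    (zhat : (n : ℕ) → (Fin n → 𝒳 × 𝒴) → 𝒳 → EuclideanSpace ℝ (Fin d)) (γv : ℝ) : Prop :=
  ∃ zn : ℕ → 𝒳 → EuclideanSpace ℝ (Fin d),
    IsCentre pX κ ℓ Z w zn ∧
    HasScoreExpansion pX κ ℓ w zhat zn γv ∧
    (NearestNeighbourClass pX κ ℓ w zn γv ∨ InfluenceClass pX κ zhat zn γv)

end

end FastRate

/-!
Write `zhat = L + R`, with `L` the leading term of the expansion and `R` its remainder, and put
`Δ(D, x) = zhat(x) - zhat^{(-i)}(x)`. Redraw the `i`-th observation of the data set `D`, which gives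
the data set `D^q`. As `zhat^{(-i)}` is the same for `D` and `D^q`, averaging over the new
observation `q` gives
`Δ(D, X_i) = R(D, X_i) + (L(D, X_i) - E_q L(D^q, X_i)) + E_q[Δ(D^q, X_i) - R(D^q, X_i)]`.
Now `(D^q, X_i)` has the law of `(D, X)` with `X` independent of `D`, so the last term contributes
at most `α_n + E ‖R(D, X)‖`. What remains is the bracket, the self-influence of the observation on
the leading term. For influence functions it is `φ_{n,X_i}(X_i, Y_i) / n`; for nearest neighbours,
redrawing one observation changes the set of neighbours in at most two places, so it is
`O(‖H_{k_n,X_i}⁻¹‖ / k_n)`. Both have mean `O(n ^ (-2 γv))`, whence `β_n ≤ α_n + O(n ^ (-2 γv))`.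
-/

namespace FastRate

section General

variable {α E : Type*} [MeasurableSpace α] [NormedAddCommGroup E] {μ : Measure α}

theorem integral_norm_le_sqrt_integral_sq [IsProbabilityMeasure μ] {f : α → E}
    (hf : MemLp f 2 μ) : ∫ a, ‖f a‖ ∂μ ≤ √(∫ a, ‖f a‖ ^ 2 ∂μ) := by
  have hvar := variance_nonneg (fun a => ‖f a‖) μ
  rw [variance_eq_sub hf.norm] at hvar
  exact Real.le_sqrt_of_sq_le (sub_nonneg.1 hvar)

theorem isBigO_integral_norm_sqrt_integral_sq [IsProbabilityMeasure μ] {ι : Type*} {l : Filter ι}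
    {f : ι → α → E} (hf : ∀ᶠ n in l, MemLp (f n) 2 μ) :
    (fun n => ∫ a, ‖f n a‖ ∂μ) =O[l] fun n => √(∫ a, ‖f n a‖ ^ 2 ∂μ) := by
  refine IsBigO.of_bound' (hf.mono fun n hn => ?_)
  rw [Real.norm_of_nonneg (by positivity), Real.norm_of_nonneg (Real.sqrt_nonneg _)]
  exact integral_norm_le_sqrt_integral_sq hn

theorem isBigO_one_integral_of_isBigO_one_integral_sq [IsProbabilityMeasure μ] {ι : Type*}
    {l : Filter ι} {f : ι → α → ℝ} (hf : ∀ n, MemLp (f n) 2 μ)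
    (hsq : (fun n => ∫ a, f n a ^ 2 ∂μ) =O[l] fun _ => (1 : ℝ)) :
    (fun n => ∫ a, f n a ∂μ) =O[l] fun _ => (1 : ℝ) := by
  have hnorm : (fun n => ∫ a, f n a ∂μ) =O[l] fun n => ∫ a, ‖f n a‖ ∂μ :=
    IsBigO.of_bound' <| Eventually.of_forall fun n =>
      (norm_integral_le_integral_norm _).trans (le_abs_self _)
  have hsqrt := hsq.sqrt (Eventually.of_forall fun _ => zero_le_one)
  refine hnorm.trans ((isBigO_integral_norm_sqrt_integral_sq (Eventually.of_forall hf)).trans ?_)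
  simpa using hsqrt

theorem integral_comp_of_measurePreserving [NormedSpace ℝ E] {β : Type*} [MeasurableSpace β]
    {ν : Measure β} {f : α → β} (hf : MeasurePreserving f μ ν) {g : β → E}
    (hg : AEStronglyMeasurable g ν) : ∫ a, g (f a) ∂μ = ∫ b, g b ∂ν := by
  rw [← hf.map_eq] at hg ⊢
  exact (integral_map hf.aemeasurable hg).symm

theorem norm_le_norm_add_norm_sub_integral_add [NormedSpace ℝ E] {u r : α → E}
    (hu : Integrable u μ) (hr : Integrable r μ) (u₀ r₀ : E) :
    ‖u₀‖ ≤ ‖r₀‖ + ‖u₀ - r₀ - ∫ a, (u a - r a) ∂μ‖ + (∫ a, ‖u a‖ ∂μ + ∫ a, ‖r a‖ ∂μ) :=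
  calc
    ‖u₀‖ = ‖r₀ + (u₀ - r₀ - ∫ a, (u a - r a) ∂μ) + (∫ a, u a ∂μ - ∫ a, r a ∂μ)‖ := by
      rw [integral_sub hu hr]; congr 1; abel
    _ ≤ ‖r₀‖ + ‖u₀ - r₀ - ∫ a, (u a - r a) ∂μ‖ + (‖∫ a, u a ∂μ‖ + ‖∫ a, r a ∂μ‖) :=
      (norm_add_le _ _).trans (add_le_add (norm_add_le _ _) (norm_sub_le _ _))
    _ ≤ _ := by gcongr <;> exact norm_integral_le_integral_norm _

theorem norm_sub_integral_le_of_ae_norm_sub_le [NormedSpace ℝ E] [CompleteSpace E]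
    [IsProbabilityMeasure μ] {f : α → E} (hf : Integrable f μ) {a₀ : E} {C : ℝ}
    (h : ∀ᵐ a ∂μ, ‖a₀ - f a‖ ≤ C) : ‖a₀ - ∫ a, f a ∂μ‖ ≤ C := by
  have hmean : a₀ - ∫ a, f a ∂μ = ∫ a, (a₀ - f a) ∂μ := by
    rw [integral_sub (integrable_const _) hf, integral_const, probReal_univ, one_smul]
  simpa [hmean] using norm_integral_le_of_norm_le_const h

theorem norm_sum_sub_sum_le_card_mul {ι F : Type*} [Fintype ι] [SeminormedAddCommGroup F]
    {u v : ι → F} {B : Finset ι} {M : ℝ} (huv : ∀ j ∉ B, u j = v j) (hu : ∀ j, ‖u j‖ ≤ M)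
    (hv : ∀ j, ‖v j‖ ≤ M) : ‖∑ j, u j - ∑ j, v j‖ ≤ B.card * (2 * M) := by
  rw [← Finset.sum_sub_distrib,
    ← Finset.sum_subset (Finset.subset_univ B) fun j _ hj => sub_eq_zero.2 (huv j hj),
    ← nsmul_eq_mul]
  exact (norm_sum_le_of_le B fun j _ =>
    (norm_sub_le_of_le (hu j) (hv j)).trans_eq (two_mul M).symm).trans_eq (Finset.sum_const _)

theorem isLittleO_of_nonneg_of_eventually_le {ι : Type*} {l : Filter ι} {f h g : ι → ℝ}
    (hf : ∀ n, 0 ≤ f n) (hfh : ∀ᶠ n in l, f n ≤ h n) (hh : h =o[l] g) : f =o[l] g :=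
  (IsBigO.of_bound' (hfh.mono fun n hn =>
    (Real.norm_of_nonneg (hf n)).trans_le (hn.trans (le_abs_self _)))).trans_isLittleO hh

theorem isLittleO_natCast_rpow {a b : ℝ} (h : a < b) :
    (fun n : ℕ => (n : ℝ) ^ a) =o[atTop] fun n : ℕ => (n : ℝ) ^ b := by
  have hreal : (fun x : ℝ => x ^ a) =o[atTop] fun x : ℝ => x ^ b := by
    refine (isLittleO_iff_tendsto' ?_).2 ((tendsto_rpow_neg_atTop (sub_pos.2 h)).congr' ?_)
    · filter_upwards [eventually_gt_atTop 0] with x hx h0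
      exact absurd h0 (Real.rpow_pos_of_pos hx b).ne'
    · filter_upwards [eventually_gt_atTop 0] with x hx
      rw [neg_sub, Real.rpow_sub hx]
  exact hreal.comp_tendsto tendsto_natCast_atTop_atTop

theorem inv_mul_isBigO_rpow_neg {u : ℕ → ℝ} {s : ℝ}
    (hu : u =O[atTop] fun n : ℕ => (n : ℝ) ^ (1 - s)) :
    (fun n : ℕ => (n : ℝ)⁻¹ * u n) =O[atTop] fun n : ℕ => (n : ℝ) ^ (-s) := by
  refine ((isBigO_refl _ _).mul hu).trans_eventuallyEq ?_
  filter_upwards [eventually_gt_atTop 0] with n hn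
  rw [← Real.rpow_neg_one, ← Real.rpow_add (by exact_mod_cast hn)]
  ring_nf

theorem continuousLinearMap_inverse_smul {𝕜 M N : Type*} [Field 𝕜] [AddCommGroup M]
    [TopologicalSpace M] [Module 𝕜 M] [ContinuousConstSMul 𝕜 M] [AddCommGroup N]
    [TopologicalSpace N] [Module 𝕜 N] [ContinuousConstSMul 𝕜 N] {c : 𝕜} (hc : c ≠ 0)
    (H : M →L[𝕜] N) : (c • H).inverse = c⁻¹ • H.inverse := by
  let e : N ≃L[𝕜] N := ContinuousLinearEquiv.smulLeft (Units.mk0 c hc)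
  have hscale : c • H = e ∘L H := rfl
  have hsymm : ∀ v, e.symm v = c⁻¹ • v := fun _ => rfl
  rw [hscale, ContinuousLinearMap.inverse_equiv_comp]
  ext v
  simp [hsymm]

theorem measurePreserving_prodMk_update_eval {ι : Type*} [Fintype ι] [DecidableEq ι]
    {X : ι → Type*} [∀ i, MeasurableSpace (X i)] (μ : ∀ i, Measure (X i)) [∀ i, SigmaFinite (μ i)]
    (i : ι) :
    MeasurePreserving (fun p : (∀ j, X j) × X i => (Function.update p.1 i p.2, p.1 i))
      ((Measure.pi μ).prod (μ i)) ((Measure.pi μ).prod (μ i)) := by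
  have hmeas : Measurable fun p : (∀ j, X j) × X i => (Function.update p.1 i p.2, p.1 i) :=
    measurable_update'.prodMk ((measurable_pi_apply i).comp measurable_fst)
  refine ⟨hmeas, (Measure.prod_eq_generateFrom generateFrom_pi
    MeasurableSpace.generateFrom_measurableSet isPiSystem_pi
    MeasurableSpace.isPiSystem_measurableSet
    (Measure.FiniteSpanningSetsIn.pi fun j => (μ j).toFiniteSpanningSetsIn)
    (μ i).toFiniteSpanningSetsIn ?_).symm⟩
  rintro _ ⟨s, hs, rfl⟩ t ht
  have hpre : (fun p : (∀ j, X j) × X i => (Function.update p.1 i p.2, p.1 i)) ⁻¹'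
      (Set.univ.pi s ×ˢ t) = Set.univ.pi (Function.update s i t) ×ˢ s i := by
    ext ⟨D, q⟩
    simp only [Set.mem_preimage, Set.mem_prod, Set.mem_univ_pi]
    refine ⟨fun ⟨hD, hq⟩ => ⟨fun j => ?_, by simpa using hD i⟩,
      fun ⟨hD, hq⟩ => ⟨fun j => ?_, by simpa using hD i⟩⟩ <;>
    · have := hD j
      obtain rfl | hj := eq_or_ne j i <;> simp_all
  rw [Measure.map_apply hmeas ((MeasurableSet.univ_pi fun j => hs j trivial).prod ht), hpre,
    Measure.prod_prod, Measure.pi_pi, Measure.pi_pi,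
    ← Finset.mul_prod_erase _ _ (Finset.mem_univ i),
    ← Finset.mul_prod_erase _ (fun j => μ j (s j)) (Finset.mem_univ i), Function.update_self,
    Finset.prod_congr rfl fun j hj => by rw [Function.update_of_ne (Finset.ne_of_mem_erase hj)]]
  ring

end General

section Rank

variable {ι T : Type*} [LinearOrder T]

theorem strictMonoOn_card_filter_lt (f : ι → T) (s : Finset ι) :
    StrictMonoOn (fun t => (s.filter fun l => f l < t).card) (f '' s) := by
  rintro _ ⟨a, ha, rfl⟩ t - hat
  refine Finset.card_lt_card ((Finset.ssubset_iff_of_subset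
    (Finset.monotone_filter_right s fun l _ hl => hl.trans hat)).2 ⟨a, ?_, by simp⟩)
  simpa [hat] using ha

variable [Fintype ι]

/-- The number of indices on which `f` is smaller than at `j`, so that `rank f j < k` says that `j`
is one of the `k` smallest indices. -/
def rank (f : ι → T) (j : ι) : ℕ :=
  (Finset.univ.filter fun l => f l < f j).card

theorem rank_eq_ite_add_card_erase [DecidableEq ι] (f : ι → T) (i j : ι) :
    rank f j = (if f i < f j then 1 else 0) +
      ((Finset.univ.erase i).filter fun l => f l < f j).card := by
  simp only [rank, Finset.card_filter]
  exact (Finset.add_sum_erase _ _ (Finset.mem_univ i)).symm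

/-- Apart from the modified index `i`, only the index of rank `k - 1` among the others can enter or
leave the `k` smallest ones. -/
theorem exists_card_le_two_forall_rank_lt_iff {f g : ι → T} (hf : Function.Injective f) {i : ι}
    (hfg : ∀ j ≠ i, f j = g j) (k : ℕ) :
    ∃ B : Finset ι, B.card ≤ 2 ∧ i ∈ B ∧ ∀ j ∉ B, (rank f j < k ↔ rank g j < k) := by
  classical
  set B := (Finset.univ.erase i).filter fun j =>
    ((Finset.univ.erase i).filter fun l => f l < f j).card + 1 = k with hB
  have hmono := strictMonoOn_card_filter_lt f (Finset.univ.erase i)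
  have hBcard : B.card ≤ 1 := Finset.card_le_one.2 fun a ha b hb => by
    simp only [hB, Finset.mem_filter] at ha hb
    exact hf (hmono.injOn ⟨a, ha.1, rfl⟩ ⟨b, hb.1, rfl⟩ (Nat.succ_injective (ha.2.trans hb.2.symm)))
  refine ⟨insert i B, (Finset.card_insert_le i B).trans (by omega), Finset.mem_insert_self i B,
    fun j hj => ?_⟩
  obtain ⟨hji, hjB⟩ : j ≠ i ∧ j ∉ B := by simpa [not_or] using hj
  have hothers : ((Finset.univ.erase i).filter fun l => g l < g j) =
      (Finset.univ.erase i).filter fun l => f l < f j :=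
    Finset.filter_congr fun l hl => by rw [hfg l (Finset.ne_of_mem_erase hl), hfg j hji]
  have hrank : ((Finset.univ.erase i).filter fun l => f l < f j).card + 1 ≠ k := by
    simpa [hB, hji] using hjB
  rw [rank_eq_ite_add_card_erase f i, rank_eq_ite_add_card_erase g i, hothers]
  split_ifs <;> omega

end Rank

section DataLaw

variable {𝒳 𝒴 : Type*} [MeasurableSpace 𝒳] [MeasurableSpace 𝒴]
  (pX : Measure 𝒳) [IsProbabilityMeasure pX] (κ : Kernel 𝒳 𝒴) [IsMarkovKernel κ]

instance isProbabilityMeasure_jointLaw : IsProbabilityMeasure (jointLaw pX κ) := by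
  unfold jointLaw; infer_instance

instance isProbabilityMeasure_dataLaw (n : ℕ) : IsProbabilityMeasure (dataLaw pX κ n) := by
  unfold dataLaw; infer_instance

theorem measurePreserving_fst_jointLaw : MeasurePreserving Prod.fst (jointLaw pX κ) pX :=
  ⟨measurable_fst, Measure.fst_compProd pX κ⟩

theorem measurePreserving_eval_dataLaw {n : ℕ} (i : Fin n) :
    MeasurePreserving (fun D : Fin n → 𝒳 × 𝒴 => D i) (dataLaw pX κ n) (jointLaw pX κ) :=
  measurePreserving_eval (fun _ => jointLaw pX κ) i

theorem measurePreserving_removeNth_dataLaw {m : ℕ} (i : Fin (m + 1)) :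
    MeasurePreserving (fun D : Fin (m + 1) → 𝒳 × 𝒴 => i.removeNth D)
      (dataLaw pX κ (m + 1)) (dataLaw pX κ m) :=
  measurePreserving_snd.comp (measurePreserving_piFinSuccAbove (fun _ => jointLaw pX κ) i)

/-- Once the `i`-th observation is redrawn, its original covariate is a new covariate independent
of the data. -/
theorem measurePreserving_update_dataLaw {n : ℕ} (i : Fin n) :
    MeasurePreserving
      (fun p : (Fin n → 𝒳 × 𝒴) × (𝒳 × 𝒴) => (Function.update p.1 i p.2, (p.1 i).1))
      ((dataLaw pX κ n).prod (jointLaw pX κ)) ((dataLaw pX κ n).prod pX) :=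
  ((MeasurePreserving.id _).prod (measurePreserving_fst_jointLaw pX κ)).comp
    (measurePreserving_prodMk_update_eval (fun _ => jointLaw pX κ) i)

variable {pX κ}

theorem ae_dataLaw_of_ae_jointLaw {P : 𝒳 × 𝒴 → Prop} (h : ∀ᵐ q ∂(jointLaw pX κ), P q) (n : ℕ) :
    ∀ᵐ D ∂(dataLaw pX κ n), ∀ i, P (D i) :=
  ae_all_iff.2 fun i => (measurePreserving_eval_dataLaw pX κ i).quasiMeasurePreserving.ae h

theorem ae_dataLaw_of_ae_fst {P : 𝒳 → Prop} (h : ∀ᵐ x ∂pX, P x) (n : ℕ) :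
    ∀ᵐ D ∂(dataLaw pX κ n), ∀ i, P (D i).1 :=
  ae_dataLaw_of_ae_jointLaw ((measurePreserving_fst_jointLaw pX κ).quasiMeasurePreserving.ae h) n

variable {E : Type*} [NormedAddCommGroup E] {n : ℕ} {F : (Fin n → 𝒳 × 𝒴) → 𝒳 → E}

theorem integrable_comp_update (hF : Integrable (fun p => F p.1 p.2) ((dataLaw pX κ n).prod pX))
    (i : Fin n) :
    Integrable (fun p : (Fin n → 𝒳 × 𝒴) × (𝒳 × 𝒴) => F (Function.update p.1 i p.2) (p.1 i).1)
      ((dataLaw pX κ n).prod (jointLaw pX κ)) :=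
  (measurePreserving_update_dataLaw pX κ i).integrable_comp_of_integrable hF

theorem ae_integrable_update (hF : Integrable (fun p => F p.1 p.2) ((dataLaw pX κ n).prod pX))
    (i : Fin n) :
    ∀ᵐ D ∂(dataLaw pX κ n),
      Integrable (fun q => F (Function.update D i q) (D i).1) (jointLaw pX κ) :=
  (integrable_comp_update hF i).prod_right_ae

theorem integral_integral_norm_update
    (hF : Integrable (fun p => F p.1 p.2) ((dataLaw pX κ n).prod pX)) (i : Fin n) :
    ∫ D, ∫ q, ‖F (Function.update D i q) (D i).1‖ ∂(jointLaw pX κ) ∂(dataLaw pX κ n) =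
      ∫ p, ‖F p.1 p.2‖ ∂((dataLaw pX κ n).prod pX) :=
  (integral_prod _ (integrable_comp_update hF i).norm).symm.trans
    (integral_comp_of_measurePreserving (measurePreserving_update_dataLaw pX κ i)
      hF.norm.aestronglyMeasurable)

end DataLaw

section LeaveOneOut

variable {𝒳 𝒴 E : Type*} [NormedAddCommGroup E]

/-- The change `zhat(x) - zhat^{(-i)}(x)` of a prediction when the `i`-th observation is left
out. -/
def looDiff (zhat : (n : ℕ) → (Fin n → 𝒳 × 𝒴) → 𝒳 → E) {m : ℕ} (i : Fin (m + 1))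
    (D : Fin (m + 1) → 𝒳 × 𝒴) (x : 𝒳) : E :=
  zhat (m + 1) D x - zhat m (i.removeNth D) x

variable [MeasurableSpace 𝒳] [MeasurableSpace 𝒴]

section Integrability

variable {pX : Measure 𝒳} [IsProbabilityMeasure pX] {κ : Kernel 𝒳 𝒴} [IsMarkovKernel κ]

theorem memLp_looDiff {zhat : (n : ℕ) → (Fin n → 𝒳 × 𝒴) → 𝒳 → E} {p : ENNReal}
    (hz : ∀ n, MemLp (fun p => zhat n p.1 p.2) p ((dataLaw pX κ n).prod pX)) {m : ℕ}
    (i : Fin (m + 1)) :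
    MemLp (fun p => looDiff zhat i p.1 p.2) p ((dataLaw pX κ (m + 1)).prod pX) :=
  (hz (m + 1)).sub ((hz m).comp_measurePreserving
    ((measurePreserving_removeNth_dataLaw pX κ i).prod (MeasurePreserving.id pX)))

end Integrability

variable [NormedSpace ℝ E]

/-- The effect of the `i`-th observation on the value of `L` at that observation's own covariate:
the difference between this value and its mean over a redraw of the observation from `ν`. The
integral is only meaningful where `L` is integrable in the redrawn observation. -/
noncomputable def selfInfluence (ν : Measure (𝒳 × 𝒴)) {n : ℕ} (L : (Fin n → 𝒳 × 𝒴) → 𝒳 → E)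
    (i : Fin n) (D : Fin n → 𝒳 × 𝒴) : E :=
  L D (D i).1 - ∫ q, L (Function.update D i q) (D i).1 ∂ν

variable {zhat : (n : ℕ) → (Fin n → 𝒳 × 𝒴) → 𝒳 → E} {m : ℕ}
  {L : (Fin (m + 1) → 𝒳 × 𝒴) → 𝒳 → E} {i : Fin (m + 1)}

/-- Redrawing the `i`-th observation does not affect the leave-one-out prediction, which therefore
cancels between the change and its mean over the redraw. -/
theorem norm_looDiff_le [CompleteSpace E] {ν : Measure (𝒳 × 𝒴)} [IsProbabilityMeasure ν]
    {D : Fin (m + 1) → 𝒳 × 𝒴}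
    (hloo : Integrable (fun q => looDiff zhat i (Function.update D i q) (D i).1) ν)
    (hR : Integrable (fun q => zhat (m + 1) (Function.update D i q) (D i).1 -
      L (Function.update D i q) (D i).1) ν) :
    ‖looDiff zhat i D (D i).1‖ ≤
      ‖zhat (m + 1) D (D i).1 - L D (D i).1‖ + ‖selfInfluence ν L i D‖ +
        (∫ q, ‖looDiff zhat i (Function.update D i q) (D i).1‖ ∂ν +
          ∫ q, ‖zhat (m + 1) (Function.update D i q) (D i).1 -
            L (Function.update D i q) (D i).1‖ ∂ν) := by
  set c := zhat m (i.removeNth D) (D i).1 with hc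
  have hsub : ∀ q, looDiff zhat i (Function.update D i q) (D i).1 -
      (zhat (m + 1) (Function.update D i q) (D i).1 - L (Function.update D i q) (D i).1) =
      L (Function.update D i q) (D i).1 - c := fun q => by
    simp only [looDiff, Fin.removeNth_update, hc]; abel
  have hL : Integrable (fun q => L (Function.update D i q) (D i).1) ν := by
    refine ((hloo.sub hR).add (integrable_const c)).congr (ae_of_all _ fun q => ?_)
    simp only [Pi.add_apply, Pi.sub_apply, hsub, sub_add_cancel]
  have hself : selfInfluence ν L i D =
      looDiff zhat i D (D i).1 - (zhat (m + 1) D (D i).1 - L D (D i).1) -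
        ∫ q, (looDiff zhat i (Function.update D i q) (D i).1 -
          (zhat (m + 1) (Function.update D i q) (D i).1 -
            L (Function.update D i q) (D i).1)) ∂ν := by
    simp_rw [hsub]
    rw [integral_sub hL (integrable_const c), integral_const, probReal_univ, one_smul]
    simp only [selfInfluence, looDiff, hc]
    abel
  rw [hself]
  exact norm_le_norm_add_norm_sub_integral_add hloo hR _ _

variable {pX : Measure 𝒳} [IsProbabilityMeasure pX] {κ : Kernel 𝒳 𝒴} [IsMarkovKernel κ]

theorem integral_norm_looDiff_le [CompleteSpace E] {b : 𝒳 × 𝒴 → ℝ}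
    (hloo : Integrable (fun p => looDiff zhat i p.1 p.2) ((dataLaw pX κ (m + 1)).prod pX))
    (hR : Integrable (fun p => zhat (m + 1) p.1 p.2 - L p.1 p.2)
      ((dataLaw pX κ (m + 1)).prod pX))
    (hRi : Integrable (fun D => zhat (m + 1) D (D i).1 - L D (D i).1) (dataLaw pX κ (m + 1)))
    (hb : Integrable b (jointLaw pX κ))
    (hself : ∀ᵐ D ∂(dataLaw pX κ (m + 1)), ‖selfInfluence (jointLaw pX κ) L i D‖ ≤ b (D i)) :
    ∫ D, ‖looDiff zhat i D (D i).1‖ ∂(dataLaw pX κ (m + 1)) ≤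
      ∫ D, ‖zhat (m + 1) D (D i).1 - L D (D i).1‖ ∂(dataLaw pX κ (m + 1)) +
        ∫ q, b q ∂(jointLaw pX κ) +
        (∫ p, ‖looDiff zhat i p.1 p.2‖ ∂((dataLaw pX κ (m + 1)).prod pX) +
          ∫ p, ‖zhat (m + 1) p.1 p.2 - L p.1 p.2‖ ∂((dataLaw pX κ (m + 1)).prod pX)) := by
  have hb_eval := measurePreserving_eval_dataLaw pX κ i
  have hbi : Integrable (fun D => b (D i)) (dataLaw pX κ (m + 1)) :=
    hb_eval.integrable_comp_of_integrable hb
  set R := fun D x => zhat (m + 1) D x - L D x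
  have hloo' := (integrable_comp_update hloo i).norm.integral_prod_left
  have hR' := (integrable_comp_update (F := R) hR i).norm.integral_prod_left
  refine (integral_mono_of_nonneg (ae_of_all _ fun _ => norm_nonneg _)
    ((hRi.norm.add hbi).add (hloo'.add hR')) ?_).trans_eq ?_
  · filter_upwards [hself, ae_integrable_update hloo i,
      ae_integrable_update (F := R) hR i] with D hD hlooD hRD
    exact (norm_looDiff_le hlooD hRD).trans (add_le_add (add_le_add le_rfl hD) le_rfl)
  · rw [integral_add' (hRi.norm.add hbi) (hloo'.add hR'), integral_add' hRi.norm hbi,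
      integral_add' hloo' hR', integral_integral_norm_update hloo,
      integral_integral_norm_update (F := R) hR,
      integral_comp_of_measurePreserving hb_eval hb.aestronglyMeasurable]

end LeaveOneOut

section StabilityRate

variable {𝒳 𝒴 : Type*} [MeasurableSpace 𝒳] [MeasurableSpace 𝒴] {d : ℕ}

/-- The self-influences of `L` are `O(a n)` in mean, uniformly over the observations: at almost
every data set they are dominated by a function of the observation whose mean is `O(a n)`. -/
def SelfInfluenceBigO (pX : Measure 𝒳) (κ : Kernel 𝒳 𝒴)
    (L : (n : ℕ) → (Fin n → 𝒳 × 𝒴) → 𝒳 → EuclideanSpace ℝ (Fin d)) (a : ℕ → ℝ) : Prop :=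
  ∃ b : ℕ → 𝒳 × 𝒴 → ℝ,
    (∀ᶠ n in atTop, Integrable (b n) (jointLaw pX κ)) ∧
    ((fun n => ∫ q, b n q ∂(jointLaw pX κ)) =O[atTop] a) ∧
    ∀ᶠ n in atTop, ∀ i : Fin n, ∀ᵐ D ∂(dataLaw pX κ n),
      ‖selfInfluence (jointLaw pX κ) (L n) i D‖ ≤ b n (D i)

theorem pointwiseLOO_nonneg (pX : Measure 𝒳) (κ : Kernel 𝒳 𝒴)
    (zhat : (n : ℕ) → (Fin n → 𝒳 × 𝒴) → 𝒳 → EuclideanSpace ℝ (Fin d)) (n : ℕ) :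
    0 ≤ pointwiseLOO pX κ zhat n := by
  cases n with
  | zero => exact le_rfl
  | succ m => exact Real.iSup_nonneg fun i => integral_nonneg fun D => norm_nonneg _

variable {pX : Measure 𝒳} [IsProbabilityMeasure pX] {κ : Kernel 𝒳 𝒴} [IsMarkovKernel κ]
  {zhat L : (n : ℕ) → (Fin n → 𝒳 × 𝒴) → 𝒳 → EuclideanSpace ℝ (Fin d)}

theorem integral_norm_looDiff_le_expectedLOO
    (hz : ∀ n, MemLp (fun p => zhat n p.1 p.2) 2 ((dataLaw pX κ n).prod pX)) {m : ℕ}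
    (i : Fin (m + 1)) :
    ∫ p, ‖looDiff zhat i p.1 p.2‖ ∂((dataLaw pX κ (m + 1)).prod pX) ≤
      expectedLOO pX κ zhat (m + 1) :=
  (integral_norm_le_sqrt_integral_sq (memLp_looDiff hz i)).trans <|
    le_ciSup (f := fun i : Fin (m + 1) =>
      √(∫ p, ‖looDiff zhat i p.1 p.2‖ ^ 2 ∂((dataLaw pX κ (m + 1)).prod pX)))
      (Set.finite_range _).bddAbove i

theorem exists_isBigO_pointwiseLOO_le_expectedLOO_add
    (hz : ∀ n, MemLp (fun p => zhat n p.1 p.2) 2 ((dataLaw pX κ n).prod pX)) {a : ℕ → ℝ}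
    (hR : MeanBigO pX κ (fun n D x => zhat n D x - L n D x) a)
    (hL : SelfInfluenceBigO pX κ L a) :
    ∃ r : ℕ → ℝ, r =O[atTop] a ∧
      ∀ᶠ n in atTop, pointwiseLOO pX κ zhat n ≤ expectedLOO pX κ zhat n + r n := by
  obtain ⟨hR_prod, hR_prod_isBigO, hR_data, hR_data_isBigO⟩ := hR
  obtain ⟨b, hb, hb_isBigO, hself⟩ := hL
  refine ⟨_, (hR_data_isBigO.add hb_isBigO).add hR_prod_isBigO, ?_⟩
  rw [← map_add_atTop_eq_nat 1, eventually_map]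
  have hshift := tendsto_add_atTop_nat 1
  filter_upwards [hshift.eventually hR_prod, hshift.eventually hR_data, hshift.eventually hb,
    hshift.eventually hself] with m hRm hRim hbm hselfm
  refine ciSup_le fun i => ?_
  have hloo := integral_norm_looDiff_le ((memLp_looDiff hz i).integrable one_le_two) hRm (hRim i)
    hbm (hselfm i)
  have hα := integral_norm_looDiff_le_expectedLOO hz i
  have hRi : ∫ D, ‖zhat (m + 1) D (D i).1 - L (m + 1) D (D i).1‖ ∂(dataLaw pX κ (m + 1)) ≤ _ :=
    le_ciSup (f := fun i : Fin (m + 1) =>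
      ∫ D, ‖zhat (m + 1) D (D i).1 - L (m + 1) D (D i).1‖ ∂(dataLaw pX κ (m + 1)))
      (Set.finite_range _).bddAbove i
  simp only [looDiff] at hloo hα ⊢
  linarith

end StabilityRate

section InfluenceFunction

variable {𝒳 𝒴 : Type*} {d : ℕ}

/-- The leading term `z_n(x) + (1/n) ∑ i, φ_{n,x}(X_i, Y_i)` of a learner with influence function
`φ`. -/
noncomputable def influenceLeadingTerm (zn : ℕ → 𝒳 → EuclideanSpace ℝ (Fin d))
    (φ : ℕ → 𝒳 → 𝒳 × 𝒴 → EuclideanSpace ℝ (Fin d)) (n : ℕ) (D : Fin n → 𝒳 × 𝒴) (x : 𝒳) :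
    EuclideanSpace ℝ (Fin d) :=
  zn n x + (n : ℝ)⁻¹ • ∑ i, φ n x (D i)

variable [MeasurableSpace 𝒳] [MeasurableSpace 𝒴] {zn : ℕ → 𝒳 → EuclideanSpace ℝ (Fin d)}
  {φ : ℕ → 𝒳 → 𝒳 × 𝒴 → EuclideanSpace ℝ (Fin d)} {n : ℕ}

theorem selfInfluence_influenceLeadingTerm {ν : Measure (𝒳 × 𝒴)} [IsProbabilityMeasure ν]
    {D : Fin n → 𝒳 × 𝒴} {i : Fin n} (hφ : Integrable (φ n (D i).1) ν)
    (hmean : ∫ q, φ n (D i).1 q ∂ν = 0) :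
    selfInfluence ν (influenceLeadingTerm zn φ n) i D = (n : ℝ)⁻¹ • φ n (D i).1 (D i) := by
  set c := influenceLeadingTerm zn φ n D (D i).1 - (n : ℝ)⁻¹ • φ n (D i).1 (D i) with hc
  have hredraw : ∀ q, influenceLeadingTerm zn φ n (Function.update D i q) (D i).1 =
      c + (n : ℝ)⁻¹ • φ n (D i).1 q := fun q => by
    have hothers : ∑ j ∈ Finset.univ.erase i, φ n (D i).1 (Function.update D i q j) =
        ∑ j ∈ Finset.univ.erase i, φ n (D i).1 (D j) :=
      Finset.sum_congr rfl fun j hj => by rw [Function.update_of_ne (Finset.ne_of_mem_erase hj)]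
    simp only [hc, influenceLeadingTerm, ← Finset.add_sum_erase _ _ (Finset.mem_univ i), hothers,
      Function.update_self, smul_add]
    abel
  have hint : Integrable (fun q => (n : ℝ)⁻¹ • φ n (D i).1 q) ν := hφ.smul (n : ℝ)⁻¹
  simp only [selfInfluence, hredraw]
  rw [integral_add (integrable_const c) hint, integral_const, probReal_univ, one_smul,
    integral_smul, hmean, hc]
  simp

variable {pX : Measure 𝒳} [IsProbabilityMeasure pX] {κ : Kernel 𝒳 𝒴} [IsMarkovKernel κ]

theorem selfInfluenceBigO_influenceLeadingTerm {a : ℕ → ℝ}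
    (hφ : ∀ᶠ n in atTop, ∀ᵐ x ∂pX,
      Integrable (φ n x) (jointLaw pX κ) ∧ ∫ q, φ n x q ∂(jointLaw pX κ) = 0)
    (hdiag : ∀ᶠ n in atTop, MemLp (fun q => φ n q.1 q) 2 (jointLaw pX κ))
    (hdiag_isBigO : (fun n : ℕ => (n : ℝ)⁻¹ * √(∫ q, ‖φ n q.1 q‖ ^ 2 ∂(jointLaw pX κ)))
      =O[atTop] a) :
    SelfInfluenceBigO pX κ (influenceLeadingTerm zn φ) a := by
  refine ⟨fun n q => (n : ℝ)⁻¹ * ‖φ n q.1 q‖, ?_, ?_, ?_⟩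
  · exact hdiag.mono fun n hn => (hn.integrable one_le_two).norm.const_mul _
  · simp_rw [integral_const_mul]
    exact ((isBigO_refl _ _).mul (isBigO_integral_norm_sqrt_integral_sq hdiag)).trans hdiag_isBigO
  · filter_upwards [hφ] with n hn i
    filter_upwards [ae_dataLaw_of_ae_fst hn n] with D hD
    rw [selfInfluence_influenceLeadingTerm (hD i).1 (hD i).2, norm_smul,
      Real.norm_of_nonneg (by positivity)]

theorem InfluenceClass.exists_selfInfluenceBigO
    {zhat : (n : ℕ) → (Fin n → 𝒳 × 𝒴) → 𝒳 → EuclideanSpace ℝ (Fin d)} {γv : ℝ}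
    (h : InfluenceClass pX κ zhat zn γv) :
    ∃ L : (n : ℕ) → (Fin n → 𝒳 × 𝒴) → 𝒳 → EuclideanSpace ℝ (Fin d),
      MeanBigO pX κ (fun n D x => zhat n D x - L n D x) (fun n => (n : ℝ) ^ (-(2 * γv))) ∧
        SelfInfluenceBigO pX κ L fun n => (n : ℝ) ^ (-(2 * γv)) := by
  obtain ⟨φ, -, hR, hφ, -, hdiag, hdiag_isBigO⟩ := h
  refine ⟨influenceLeadingTerm zn φ, ?_, ?_⟩
  · simpa only [influenceLeadingTerm, sub_add_eq_sub_sub] using hR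
  · refine selfInfluenceBigO_influenceLeadingTerm ?_ (hdiag.mono fun n hn => hn.1)
      (inv_mul_isBigO_rpow_neg hdiag_isBigO)
    exact hφ.mono fun n hn => hn.mono fun x hx => ⟨hx.1.integrable one_le_two, hx.2⟩

end InfluenceFunction

section NearestNeighbours

variable {𝒳 𝒴 : Type*}

section Indices

variable [MetricSpace 𝒳] {n : ℕ}

/-- The lexicographic key by which the observations are sorted into nearest neighbours of `x`: the
distance to `x`, then the index. -/
def proximityKey (D : Fin n → 𝒳 × 𝒴) (x : 𝒳) (j : Fin n) : ℝ ×ₗ Fin n :=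
  toLex (dist (D j).1 x, j)

theorem proximityKey_injective (D : Fin n → 𝒳 × 𝒴) (x : 𝒳) :
    Function.Injective (proximityKey D x) := fun _ _ h =>
  congrArg Prod.snd (toLex.injective h)

theorem mem_nearestIndices_iff_rank_lt {k : ℕ} {D : Fin n → 𝒳 × 𝒴} {x : 𝒳} {j : Fin n} :
    j ∈ nearestIndices k D x ↔ rank (proximityKey D x) j < k := by
  simp only [nearestIndices, rank, proximityKey, Prod.Lex.toLex_lt_toLex, Finset.mem_filter,
    Finset.mem_univ, true_and]

theorem exists_card_le_two_mem_nearestIndices_update_iff (D : Fin n → 𝒳 × 𝒴) (i : Fin n)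
    (q : 𝒳 × 𝒴) (k : ℕ) (x : 𝒳) :
    ∃ B : Finset (Fin n), B.card ≤ 2 ∧ i ∈ B ∧
      ∀ j ∉ B, (j ∈ nearestIndices k D x ↔ j ∈ nearestIndices k (Function.update D i q) x) := by
  simp only [mem_nearestIndices_iff_rank_lt]
  refine exists_card_le_two_forall_rank_lt_iff (proximityKey_injective D x) (fun j hj => ?_) k
  rw [proximityKey, proximityKey, Function.update_of_ne hj]

end Indices

variable {d : ℕ} {ℓ : EuclideanSpace ℝ (Fin d) → 𝒴 → ℝ}
  {w : (n : ℕ) → (Fin n → 𝒳 × 𝒴) → Fin n → 𝒳 → ℝ}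

open scoped Classical in
theorem norm_score_sub_score_update_le [MetricSpace 𝒳] {n k : ℕ}
    (hw : ∀ D i x, w n D i x = if i ∈ nearestIndices k D x then 1 else 0)
    {D : Fin n → 𝒳 × 𝒴} {q : 𝒳 × 𝒴} {z : EuclideanSpace ℝ (Fin d)} {M : ℝ}
    (hD : ∀ j, ‖gradient (fun z => ℓ z (D j).2) z‖ ≤ M)
    (hq : ‖gradient (fun z => ℓ z q.2) z‖ ≤ M) (i : Fin n) (x : 𝒳) :
    ‖score ℓ w n D x z - score ℓ w n (Function.update D i q) x z‖ ≤ 4 * M := by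
  obtain ⟨B, hB, hiB, hmem⟩ := exists_card_le_two_mem_nearestIndices_update_iff D i q k x
  have hM : 0 ≤ M := (norm_nonneg _).trans hq
  have hterm : ∀ D' : Fin n → 𝒳 × 𝒴, (∀ j, ‖gradient (fun z => ℓ z (D' j).2) z‖ ≤ M) →
      ∀ j, ‖w n D' j x • gradient (fun z => ℓ z (D' j).2) z‖ ≤ M := fun D' hD' j => by
    rw [hw]
    split_ifs
    · rw [one_smul]; exact hD' j
    · rwa [zero_smul, norm_zero]
  have hD' : ∀ j, ‖gradient (fun z => ℓ z (Function.update D i q j).2) z‖ ≤ M :=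
    (Function.forall_update_iff D fun _ q => ‖gradient (fun z => ℓ z q.2) z‖ ≤ M).2
      ⟨hq, fun j _ => hD j⟩
  refine (norm_sum_sub_sum_le_card_mul (B := B) (fun j hj => ?_) (hterm D hD)
    (hterm _ hD')).trans ?_
  · rw [hw, hw, if_congr (hmem j hj) rfl rfl,
      Function.update_of_ne (ne_of_mem_of_not_mem hiB hj).symm]
  · have : (B.card : ℝ) ≤ 2 := by exact_mod_cast hB
    nlinarith

theorem norm_inverse_inv_smul_le {E : Type*} [NormedAddCommGroup E] [NormedSpace ℝ E]
    {H : E →L[ℝ] E} {a b C : ℝ} (ha : a ≠ 0) (hb : 0 < b) (hH : ‖((a / b) • H).inverse‖ ≤ C)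
    (v : E) : ‖H.inverse (a⁻¹ • v)‖ ≤ b⁻¹ * C * ‖v‖ := by
  have hrescale : H.inverse (a⁻¹ • v) = b⁻¹ • ((a / b) • H).inverse v := by
    rw [continuousLinearMap_inverse_smul (div_ne_zero ha hb.ne'), map_smul,
      smul_apply, smul_smul]
    congr 1
    field_simp
  rw [hrescale, norm_smul, Real.norm_of_nonneg (inv_nonneg.2 hb.le), mul_assoc]
  gcongr
  exact ContinuousLinearMap.le_of_opNorm_le _ hH v

variable [MeasurableSpace 𝒳] [MeasurableSpace 𝒴]

/-- The leading term `z_n(x) - H_{n,x}⁻¹ (1/n) ∑ i, w_{n,i}(x) ∇ℓ(z_n(x); Y_i)` of the score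
expansion. -/
noncomputable def scoreLeadingTerm (pX : Measure 𝒳) (κ : Kernel 𝒳 𝒴)
    (ℓ : EuclideanSpace ℝ (Fin d) → 𝒴 → ℝ) (w : (n : ℕ) → (Fin n → 𝒳 × 𝒴) → Fin n → 𝒳 → ℝ)
    (zn : ℕ → 𝒳 → EuclideanSpace ℝ (Fin d)) (n : ℕ) (D : Fin n → 𝒳 × 𝒴) (x : 𝒳) :
    EuclideanSpace ℝ (Fin d) :=
  zn n x - (weightedHess pX κ ℓ w zn n x).inverse ((n : ℝ)⁻¹ • score ℓ w n D x (zn n x))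

variable {pX : Measure 𝒳} {κ : Kernel 𝒳 𝒴}
  {Z : Set (EuclideanSpace ℝ (Fin d))} {zn : ℕ → 𝒳 → EuclideanSpace ℝ (Fin d)}

theorem RegularCost.exists_norm_gradient_le (h : RegularCost pX κ ℓ Z) :
    ∃ M : ℝ, ∀ᵐ q ∂(jointLaw pX κ), ∀ z ∈ Z, ‖gradient (fun z => ℓ z q.2) z‖ ≤ M := by
  obtain ⟨-, M, hM⟩ := h
  exact ⟨M, (ae_of_ae_map measurable_snd.aemeasurable hM).mono fun q hq z hz => (hq z hz).2⟩

theorem HasScoreExpansion.meanBigO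
    {zhat : (n : ℕ) → (Fin n → 𝒳 × 𝒴) → 𝒳 → EuclideanSpace ℝ (Fin d)} {γv : ℝ}
    (h : HasScoreExpansion pX κ ℓ w zhat zn γv) :
    MeanBigO pX κ (fun n D x => zhat n D x - scoreLeadingTerm pX κ ℓ w zn n D x)
      (fun n => (n : ℝ) ^ (-(2 * γv))) := by
  simpa only [HasScoreExpansion, scoreLeadingTerm, ← sub_add] using h

variable [MetricSpace 𝒳]

open scoped Classical in
theorem norm_scoreLeadingTerm_sub_update_le {n k : ℕ} (hk : 0 < k)
    (hw : ∀ D i x, w n D i x = if i ∈ nearestIndices k D x then 1 else 0)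
    {D : Fin n → 𝒳 × 𝒴} {q : 𝒳 × 𝒴} {x : 𝒳} {M C : ℝ}
    (hD : ∀ j, ‖gradient (fun z => ℓ z (D j).2) (zn n x)‖ ≤ M)
    (hq : ‖gradient (fun z => ℓ z q.2) (zn n x)‖ ≤ M)
    (hH : ‖(((n : ℝ) / (k : ℝ)) • weightedHess pX κ ℓ w zn n x).inverse‖ ≤ C) (i : Fin n) :
    ‖scoreLeadingTerm pX κ ℓ w zn n D x -
      scoreLeadingTerm pX κ ℓ w zn n (Function.update D i q) x‖ ≤ (k : ℝ)⁻¹ * C * (4 * M) := by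
  have hn : (n : ℝ) ≠ 0 := Nat.cast_ne_zero.2 i.pos.ne'
  have hC : 0 ≤ C := (norm_nonneg _).trans hH
  rw [scoreLeadingTerm, scoreLeadingTerm, sub_sub_sub_cancel_left, norm_sub_rev, ← map_sub,
    ← smul_sub]
  refine (norm_inverse_inv_smul_le hn (by exact_mod_cast hk) hH _).trans ?_
  gcongr
  exact norm_score_sub_score_update_le hw hD hq i x

open scoped Classical in
theorem norm_selfInfluence_scoreLeadingTerm_le [IsProbabilityMeasure pX] [IsMarkovKernel κ]
    {n k : ℕ} (hk : 0 < k)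
    (hw : ∀ D i x, w n D i x = if i ∈ nearestIndices k D x then 1 else 0)
    {D : Fin n → 𝒳 × 𝒴} {i : Fin n} {M C : ℝ}
    (hint : Integrable
      (fun q => scoreLeadingTerm pX κ ℓ w zn n (Function.update D i q) (D i).1) (jointLaw pX κ))
    (hD : ∀ j, ‖gradient (fun z => ℓ z (D j).2) (zn n (D i).1)‖ ≤ M)
    (hM : ∀ᵐ q ∂(jointLaw pX κ), ‖gradient (fun z => ℓ z q.2) (zn n (D i).1)‖ ≤ M)
    (hH : ‖(((n : ℝ) / (k : ℝ)) • weightedHess pX κ ℓ w zn n (D i).1).inverse‖ ≤ C) :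
    ‖selfInfluence (jointLaw pX κ) (scoreLeadingTerm pX κ ℓ w zn n) i D‖ ≤
      (k : ℝ)⁻¹ * C * (4 * M) :=
  norm_sub_integral_le_of_ae_norm_sub_le hint <| hM.mono fun _ hq =>
    norm_scoreLeadingTerm_sub_update_le hk hw hD hq hH i

theorem NearestNeighbourClass.selfInfluenceBigO [IsProbabilityMeasure pX] [IsMarkovKernel κ]
    {γv : ℝ} (hNN : NearestNeighbourClass pX κ ℓ w zn γv) (hreg : RegularCost pX κ ℓ Z)
    (hzn : ∀ᶠ n in atTop, ∀ᵐ x ∂pX, zn n x ∈ Z)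
    (hint : ∀ᶠ n in atTop, Integrable (fun p => scoreLeadingTerm pX κ ℓ w zn n p.1 p.2)
      ((dataLaw pX κ n).prod pX)) :
    SelfInfluenceBigO pX κ (scoreLeadingTerm pX κ ℓ w zn) fun n => (n : ℝ) ^ (-(2 * γv)) := by
  obtain ⟨k, -, hk, hw, g, hg, hg_isBigO, hH⟩ := hNN
  obtain ⟨M, hM⟩ := hreg.exists_norm_gradient_le
  have hk_pos : ∀ᶠ n in atTop, 0 < k n := by
    filter_upwards [hk.isBigO_symm.eq_zero_imp, eventually_gt_atTop 0] with n hn hn_pos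
    refine Nat.pos_of_ne_zero fun hk_zero => ?_
    exact (Real.rpow_pos_of_pos (Nat.cast_pos.2 hn_pos) _).ne' (hn (by simp [hk_zero]))
  have hk_inv : (fun n => (k n : ℝ)⁻¹) =O[atTop] fun n : ℕ => (n : ℝ) ^ (-(2 * γv)) := by
    simpa only [Real.rpow_neg (Nat.cast_nonneg _)] using hk.inv.isBigO
  refine ⟨fun n q => (k n : ℝ)⁻¹ * g n q.1 * (4 * M), Eventually.of_forall fun n => ?_, ?_, ?_⟩
  · exact (((measurePreserving_fst_jointLaw pX κ).integrable_comp_of_integrable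
      ((hg n).integrable one_le_two)).const_mul _).mul_const _
  · simp_rw [integral_mul_const, integral_const_mul, fun n => integral_comp_of_measurePreserving
      (measurePreserving_fst_jointLaw pX κ) (hg n).aestronglyMeasurable]
    simpa using (hk_inv.mul (isBigO_one_integral_of_isBigO_one_integral_sq hg hg_isBigO)).mul
      (isBigO_const_const (4 * M) one_ne_zero atTop)
  · filter_upwards [hk_pos, hzn, hint, hH] with n hkn hznn hintn hHn i
    filter_upwards [ae_dataLaw_of_ae_fst (hznn.and hHn) n, ae_dataLaw_of_ae_jointLaw hM n,
      ae_integrable_update hintn i] with D hD hMD hintD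
    exact norm_selfInfluence_scoreLeadingTerm_le hkn (hw n) hintD (fun j => hMD j _ (hD i).1)
      (hM.mono fun q hq => hq _ (hD i).1) (hD i).2

end NearestNeighbours

section Learner

variable {𝒳 𝒴 : Type*} [MeasurableSpace 𝒳] [MeasurableSpace 𝒴] {d : ℕ}
  {pX : Measure 𝒳} [IsProbabilityMeasure pX] {κ : Kernel 𝒳 𝒴} [IsMarkovKernel κ]
  {ℓ : EuclideanSpace ℝ (Fin d) → 𝒴 → ℝ} {Z : Set (EuclideanSpace ℝ (Fin d))}
  {w : (n : ℕ) → (Fin n → 𝒳 × 𝒴) → Fin n → 𝒳 → ℝ}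
  {zhat : (n : ℕ) → (Fin n → 𝒳 × 𝒴) → 𝒳 → EuclideanSpace ℝ (Fin d)}

theorem IsWeightedLearner.memLp (h : IsWeightedLearner pX κ ℓ Z w zhat)
    (hZ : Bornology.IsBounded Z) (p : ENNReal) (n : ℕ) :
    MemLp (fun q => zhat n q.1 q.2) p ((dataLaw pX κ n).prod pX) := by
  obtain ⟨C, hC⟩ := hZ.exists_norm_le
  exact .of_bound (h.measurable_zhat n).aestronglyMeasurable C
    (ae_of_all _ fun q => hC _ (h.mem ..))

theorem ExpansionConditions.exists_selfInfluenceBigO [MetricSpace 𝒳] {γv : ℝ}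
    (h : ExpansionConditions pX κ ℓ Z w zhat γv) (hreg : RegularCost pX κ ℓ Z)
    (hz : ∀ n, Integrable (fun p => zhat n p.1 p.2) ((dataLaw pX κ n).prod pX)) :
    ∃ L : (n : ℕ) → (Fin n → 𝒳 × 𝒴) → 𝒳 → EuclideanSpace ℝ (Fin d),
      MeanBigO pX κ (fun n D x => zhat n D x - L n D x) (fun n => (n : ℝ) ^ (-(2 * γv))) ∧
        SelfInfluenceBigO pX κ L fun n => (n : ℝ) ^ (-(2 * γv)) := by
  obtain ⟨zn, hzn, hscore, hNN | hφ⟩ := h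
  · have hR := hscore.meanBigO
    refine ⟨_, hR, hNN.selfInfluenceBigO hreg (hzn.mono fun n hn => hn.mono fun x hx => hx.1) ?_⟩
    filter_upwards [hR.1] with n hRn
    exact ((hz n).sub hRn).congr (ae_of_all _ fun p => sub_sub_cancel _ _)
  · exact hφ.exists_selfInfluenceBigO

end Learner

end FastRate

theorem mainTheorem7_general {𝒳 𝒴 : Type*} [MetricSpace 𝒳] [MeasurableSpace 𝒳]
    [MeasurableSpace 𝒴] {d : ℕ}
    (pX : Measure 𝒳) [IsProbabilityMeasure pX] (κ : Kernel 𝒳 𝒴) [IsMarkovKernel κ]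
    (ℓ : EuclideanSpace ℝ (Fin d) → 𝒴 → ℝ) (Z : Set (EuclideanSpace ℝ (Fin d)))
    (w : (n : ℕ) → (Fin n → 𝒳 × 𝒴) → Fin n → 𝒳 → ℝ)
    (zhat : (n : ℕ) → (Fin n → 𝒳 × 𝒴) → 𝒳 → EuclideanSpace ℝ (Fin d)) (γv : ℝ)
    (hreg : FastRate.RegularCost pX κ ℓ Z)
    (hzhat : ∀ n, MemLp (fun p => zhat n p.1 p.2) 2 ((FastRate.dataLaw pX κ n).prod pX))
    (hexp : FastRate.ExpansionConditions pX κ ℓ Z w zhat γv) :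
    ∃ r : ℕ → ℝ, r =O[atTop] (fun n : ℕ => (n : ℝ) ^ (-(2 * γv))) ∧
      ∀ᶠ n in atTop,
        FastRate.pointwiseLOO pX κ zhat n ≤ FastRate.expectedLOO pX κ zhat n + r n := by
  obtain ⟨L, hR, hL⟩ := hexp.exists_selfInfluenceBigO hreg fun n => (hzhat n).integrable one_le_two
  exact FastRate.exists_isBigO_pointwiseLOO_le_expectedLOO_add hzhat hR hL

theorem mainTheorem7 {𝒳 𝒴 : Type*} [MetricSpace 𝒳] [SecondCountableTopology 𝒳]
    [MeasurableSpace 𝒳] [BorelSpace 𝒳] [MeasurableSpace 𝒴] {d : ℕ}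
    (pX : Measure 𝒳) [IsProbabilityMeasure pX] (κ : Kernel 𝒳 𝒴) [IsMarkovKernel κ]
    (ℓ : EuclideanSpace ℝ (Fin d) → 𝒴 → ℝ) (Z : Set (EuclideanSpace ℝ (Fin d)))
    (w : (n : ℕ) → (Fin n → 𝒳 × 𝒴) → Fin n → 𝒳 → ℝ)
    (zhat : (n : ℕ) → (Fin n → 𝒳 × 𝒴) → 𝒳 → EuclideanSpace ℝ (Fin d)) (γv : ℝ)
    (hmeas : Measurable fun p : EuclideanSpace ℝ (Fin d) × 𝒴 => ℓ p.1 p.2)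
    (hcost : FastRate.SmoothExpectedCost κ ℓ Z)
    (hreg : FastRate.RegularCost pX κ ℓ Z)
    (hopt : FastRate.OptimalityConditions κ ℓ Z)
    (hlearner : FastRate.IsWeightedLearner pX κ ℓ Z w zhat)
    (hrate : FastRate.HasVariabilityRate pX κ zhat γv)
    (hexp : FastRate.ExpansionConditions pX κ ℓ Z w zhat γv)
    (hstab : FastRate.expectedLOO pX κ zhat =o[atTop] fun n : ℕ => (n : ℝ) ^ (-(1 / 2) : ℝ))
    (hγ : 1 / 4 < γv) :
    FastRate.pointwiseLOO pX κ zhat =o[atTop] fun n : ℕ => (n : ℝ) ^ (-(1 / 2) : ℝ) := by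
  obtain ⟨r, hr, hle⟩ := mainTheorem7_general pX κ ℓ Z w zhat γv hreg
    (hlearner.memLp hopt.2.1 2) hexp
  exact FastRate.isLittleO_of_nonneg_of_eventually_le (FastRate.pointwiseLOO_nonneg pX κ zhat) hle
    (hstab.add (hr.trans_isLittleO (FastRate.isLittleO_natCast_rpow (by linarith))))
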